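/- Let $1<p<\infty$, $p'=p/(p-1)$, and let $\lambda_p,\Lambda>0$. On $\mathbb C^n$ write $\langle a,b\rangle=\sum_i a_i\overline{b_i}$ and $\mathcal J_p(\alpha+i\beta)=\alpha/p+i\beta/p'$ for $\alpha,\beta\in\mathbb R^n$. A measurable function $A:\Omega\to\mathbb C^{n\times n}$ on an open set $\Omega\subset\mathbb R^n$ is called $p$-elliptic with constants $\lambda_p,\Lambda$ if, for a.e. $x\in\Omega$, $$\operatorname{Re}\langle A(x)\xi,\mathcal J_p\xi\rangle\ge\lambda_p|\xi|^2\quad\text{and}\quad|\langle A(x)\xi,\eta\rangle|\le\Lambda|\xi||\eta|\qquad\text{for all }\xi,\eta\in\mathbb C^n .$$ For a function $f:\Omega\to\mathbb C$, $\nabla f$ denotes the weak gradient if $f\in W^{1,1}_{loc}(\Omega;\mathbb C)$. In general, $\nabla f$ denotes the measurable field $G:\Omega\to\mathbb C^n$ (unique up to null sets if it exists, and equal a.e. to the weak gradient if $f\in W^{1,1}_{loc}$) such that $G=0$ a.e. on $\{f=0\}$ and such that, for every $\varphi\in C_c^\infty(\mathbb C\setminus\{0\};\mathbb C)$, the function $\varphi\circ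 f$ is in $W^{1,1}_{loc}(\Omega;\mathbb C)$ with weak derivatives $\partial_i(\varphi\circ f)=D\varphi(f)[G_i]$, where $D\varphi$ is the real differential. Expressions $|u|^su$, and $|u|^{p-2}|\nabla u|^2$, are read as $0$ where $u=0$. Theorem. There exists $\lambda_p'>0$, depending only on $p$, $\lambda_p$ and $\Lambda$, such that the following holds for every $n$, every open $\Omega\subset\mathbb R^n$, every $A$ on $\Omega$ that is $p$-elliptic with constants $\lambda_p,\Lambda$, every nonnegative, bounded, measurable function $\chi$ on $\Omega$, and every $u:\Omega\to\mathbb C$ with $|u|^{(p-2)/2}u\in W^{1,2}_{loc}(\Omega;\mathbb C)$. The gradients $\nabla u$ and $\nabla(|u|^{p-2}u)$ exist, and $$\operatorname{Re}\int_\Omega\langle A\nabla u,\nabla(|u|^{p-2}u)\rangle\,\chi\,dx\;\ge\;\lambda_p'\int_\Omega|u|^{p-2}|\nabla u|^2\,\chi\,dx .$$ Here the integrand $\operatorname{Re}\langle A\nabla u,\nabla(|u|^{p-2}u)\rangle\chi$ is nonnegative a.e., and the inequality holds between integrals in $[0,\infty]$, the left-hand side being the integral of this real part. If the right-hand side is finite,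 then $\langle A\nabla u,\nabla(|u|^{p-2}u)\rangle\chi$ is integrable on $\Omega$ and the inequality holds between finite integrals as written. -/

import Mathlib

open MeasureTheory
open scoped ContDiff ENNReal ComplexConjugate

/-- The form `⟨M ξ, η⟩ = ∑ i, ∑ j, M i j * ξ j * conj (η i)`. -/
noncomputable def sesqForm {n : ℕ} (M : Matrix (Fin n) (Fin n) ℂ)
    (ξ η : EuclideanSpace ℂ (Fin n)) : ℂ :=
  ∑ i, ∑ j, M i j * ξ j * conj (η i)

/-- The real-linear map `𝒥_p (α + i β) = α / p + i β / p'` on `ℂⁿ`, where `p' = p / (p - 1)`. -/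
noncomputable def Jmap {n : ℕ} (p : ℝ) (ξ : EuclideanSpace ℂ (Fin n)) :
    EuclideanSpace ℂ (Fin n) :=
  WithLp.toLp 2 fun i => (⟨(ξ i).re / p, (ξ i).im / (p / (p - 1))⟩ : ℂ)

/-- `A` is (measurable and) `p`-elliptic on `Ω` with lower constant `lam` and upper bound `Lam`. -/
structure IsPElliptic {n : ℕ} (Ω : Set (EuclideanSpace ℝ (Fin n)))
    (A : EuclideanSpace ℝ (Fin n) → Matrix (Fin n) (Fin n) ℂ) (p lam Lam : ℝ) : Prop where
  measurable : ∀ i j, AEStronglyMeasurable (fun x => A x i j) (volume.restrict Ω)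
  lower : ∀ᵐ x ∂(volume.restrict Ω), ∀ ξ : EuclideanSpace ℂ (Fin n),
    lam * ‖ξ‖ ^ 2 ≤ (sesqForm (A x) ξ (Jmap p ξ)).re
  upper : ∀ᵐ x ∂(volume.restrict Ω), ∀ ξ η : EuclideanSpace ℂ (Fin n),
    ‖sesqForm (A x) ξ η‖ ≤ Lam * ‖ξ‖ * ‖η‖

/-- `f` is a `W^{1,1}_loc(Ω; ℂ)` function whose distributional gradient is `G`. -/
structure HasWeakGradient {n : ℕ} (Ω : Set (EuclideanSpace ℝ (Fin n)))
    (f : EuclideanSpace ℝ (Fin n) → ℂ)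
    (G : EuclideanSpace ℝ (Fin n) → EuclideanSpace ℂ (Fin n)) : Prop where
  locallyIntegrableOn : LocallyIntegrableOn f Ω volume
  locallyIntegrableOn_grad : LocallyIntegrableOn G Ω volume
  integral_eq : ∀ φ : EuclideanSpace ℝ (Fin n) → ℝ, ContDiff ℝ ∞ φ → HasCompactSupport φ →
    tsupport φ ⊆ Ω → ∀ i : Fin n,
      ∫ x in Ω, ((fderiv ℝ φ x (EuclideanSpace.single i 1) : ℝ) : ℂ) * f x
        = - ∫ x in Ω, ((φ x : ℝ) : ℂ) * G x i

/-- `f ∈ W^{1,2}_loc(Ω; ℂ)`. -/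
def MemW12Loc {n : ℕ} (Ω : Set (EuclideanSpace ℝ (Fin n)))
    (f : EuclideanSpace ℝ (Fin n) → ℂ) : Prop :=
  ∃ G : EuclideanSpace ℝ (Fin n) → EuclideanSpace ℂ (Fin n), HasWeakGradient Ω f G ∧
    ∀ K : Set (EuclideanSpace ℝ (Fin n)), IsCompact K → K ⊆ Ω →
      MemLp f 2 (volume.restrict K) ∧ MemLp G 2 (volume.restrict K)

/-- The gradient of a measurable function `f` that need not be in `W^{1,1}_loc`: a measurable
field `G`, vanishing a.e. on `{f = 0}`, such that the chain rule `∇(φ ∘ f) = Dφ(f) G` holds weakly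
for all smooth compactly supported `φ : ℂ → ℂ` that vanish near `0`. Such a `G` is unique up to
null sets (take for `φ` functions equal to the identity on large annuli about `0`), it is the weak
gradient of `f` if `f ∈ W^{1,1}_loc(Ω)`, and it is `Dψ(g) ∇g` on `{f ≠ 0}` if `f = ψ ∘ g` with
`g ∈ W^{1,1}_loc(Ω)` and `ψ` a homeomorphism of `ℂ` that fixes `0` and is a diffeomorphism away
from `0`. -/
structure HasGeneralizedGradient {n : ℕ} (Ω : Set (EuclideanSpace ℝ (Fin n)))
    (f : EuclideanSpace ℝ (Fin n) → ℂ)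
    (G : EuclideanSpace ℝ (Fin n) → EuclideanSpace ℂ (Fin n)) : Prop where
  aestronglyMeasurable : AEStronglyMeasurable G (volume.restrict Ω)
  chain_rule : ∀ φ : ℂ → ℂ, ContDiff ℝ ∞ φ → HasCompactSupport φ → (0 : ℂ) ∉ tsupport φ →
    HasWeakGradient Ω (fun x => φ (f x))
      (fun x => WithLp.toLp 2 fun i => fderiv ℝ φ (f x) (G x i))
  eq_zero : ∀ᵐ x ∂(volume.restrict Ω), f x = 0 → G x = 0

/-- `G` is the gradient of `f` in `Ω`, in the weak sense or in the generalized sense (the two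
agree a.e. when both exist). -/
def HasGradient {n : ℕ} (Ω : Set (EuclideanSpace ℝ (Fin n)))
    (f : EuclideanSpace ℝ (Fin n) → ℂ)
    (G : EuclideanSpace ℝ (Fin n) → EuclideanSpace ℂ (Fin n)) : Prop :=
  HasWeakGradient Ω f G ∨ HasGeneralizedGradient Ω f G

/-- The function `|u|^s u`, with value `0` where `u = 0`. -/
noncomputable def absPowMul {n : ℕ} (s : ℝ) (u : EuclideanSpace ℝ (Fin n) → ℂ) :
    EuclideanSpace ℝ (Fin n) → ℂ :=
  fun x => ((‖u x‖ ^ s : ℝ) : ℂ) * u x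

/-! Put v = |u|^{(p-2)/2} u, w = |u|^{p-2} u and τ = (p-2)/p. Then u = |v|^{-τ} v and w = |v|^τ v,
so both gradients come from ∇v by the chain rule for power maps. Where v ≠ 0, write ∇v = θ(a + ib)
with θ = v/|v| and a, b real vectors. A power map rescales the radial part a relative to the
tangential part b: ∇u = |v|^{-τ} θ((1-τ)a + ib) and ∇w = |v|^τ θ((1+τ)a + ib).

In the sesquilinear form θ and the powers of |v| cancel. With ξ = i((1-τ)a + ib), the identity
(1-τ)(p-1) = 1+τ gives p 𝒥_p ξ = i((1+τ)a + ib). Hence ⟨A∇u, ∇w⟩ = p⟨Aξ, 𝒥_p ξ⟩ and |ξ|² =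
|u|^{p-2}|∇u|² (`exists_sesqForm_powMapDeriv_eq`). Ellipticity then bounds the integrand pointwise,
from below with constant p λ_p and from above with p Λ (`sesqForm_powMapDeriv_bounds`).

The analytic work is to justify these gradients. Power maps may be singular at 0, but φ composed
with one is smooth when φ is supported away from 0. The smooth chain rule `HasWeakGradient.comp`,
proved by mollification, therefore yields the generalized gradients of u and w. By
`HasGeneralizedGradient.ae_eq` and `HasWeakGradient.ae_eq_zero`, gradients given in either sense
agree a.e. with the explicit ones. -/

/-! ### Mollification and the chain rule for integrable functions on the whole space. -/

section Mollification

open Filter Topology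
open scoped Convolution

variable {E : Type*} [NormedAddCommGroup E] [NormedSpace ℝ E] [FiniteDimensional ℝ E]

/-- A sequence of bump functions at the origin whose supports shrink to the origin. -/
noncomputable def mollifier (E : Type*) [NormedAddCommGroup E] [NormedSpace ℝ E]
    [FiniteDimensional ℝ E] (k : ℕ) : ContDiffBump (0 : E) where
  rIn := 1 / ((k : ℝ) + 1)
  rOut := 2 * (1 / ((k : ℝ) + 1))
  rIn_pos := by positivity
  rIn_lt_rOut := by
    have : 0 < 1 / ((k : ℝ) + 1) := by positivity
    linarith

theorem tendsto_mollifier_rOut : Tendsto (fun k => (mollifier E k).rOut) atTop (𝓝 0) := by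
  have := (tendsto_one_div_add_atTop_nhds_zero_nat (𝕜 := ℝ)).const_mul 2
  simpa [mollifier] using this

variable [MeasurableSpace E] {μ : Measure E}

theorem norm_mollify_le {F : Type*} [NormedAddCommGroup F] [NormedSpace ℝ F]
    (g : E → F) (k : ℕ) (x : E) :
    ‖((mollifier E k).normed μ ⋆[.lsmul ℝ ℝ, μ] g) x‖
      ≤ ((mollifier E k).normed μ ⋆[.lsmul ℝ ℝ, μ] fun y => ‖g y‖) x := by
  refine (norm_integral_le_integral_norm _).trans_eq (integral_congr_ae (.of_forall fun t => ?_))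
  simp [norm_smul, abs_of_nonneg ((mollifier E k).nonneg_normed t)]

variable [BorelSpace E] [μ.IsAddHaarMeasure]

/-- Lebesgue differentiation; it requires `rOut ≤ K * rIn`, which is why `mollifier` keeps the two
radii in the fixed ratio 2. -/
theorem ae_tendsto_mollify {F : Type*} [NormedAddCommGroup F] [NormedSpace ℝ F] [CompleteSpace F]
    {g : E → F} (hg : LocallyIntegrable g μ) :
    ∀ᵐ x ∂μ, Tendsto (fun k => ((mollifier E k).normed μ ⋆[.lsmul ℝ ℝ, μ] g) x) atTop
      (𝓝 (g x)) :=
  ContDiffBump.ae_convolution_tendsto_right_of_locallyIntegrable (K := 2)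
    tendsto_mollifier_rOut (Eventually.of_forall fun _ => le_rfl) hg

theorem integrable_mollify {F : Type*} [NormedAddCommGroup F] [NormedSpace ℝ F]
    {g : E → F} (hg : Integrable g μ) (k : ℕ) :
    Integrable ((mollifier E k).normed μ ⋆[.lsmul ℝ ℝ, μ] g) μ :=
  (mollifier E k).integrable_normed.integrable_convolution _ hg

theorem integral_mollify_norm {F : Type*} [NormedAddCommGroup F] [NormedSpace ℝ F]
    {g : E → F} (hg : Integrable g μ) (k : ℕ) :
    ∫ x, ((mollifier E k).normed μ ⋆[.lsmul ℝ ℝ, μ] fun y => ‖g y‖) x ∂μ = ∫ x, ‖g x‖ ∂μ := by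
  rw [integral_convolution _ (mollifier E k).integrable_normed hg.norm,
    (mollifier E k).integral_normed]
  simp

/-- Mollifications of an integrable function converge in `L¹`. -/
theorem tendsto_integral_norm_mollify_sub {F : Type*} [NormedAddCommGroup F] [NormedSpace ℝ F]
    [CompleteSpace F] {g : E → F} (hg : Integrable g μ) :
    Tendsto (fun k => ∫ x, ‖((mollifier E k).normed μ ⋆[.lsmul ℝ ℝ, μ] g) x - g x‖ ∂μ) atTop
      (𝓝 0) := by
  set d : ℕ → E → ℝ := fun k x =>
    ‖((mollifier E k).normed μ ⋆[.lsmul ℝ ℝ, μ] g) x - g x‖ with hd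
  set m : ℕ → E → ℝ := fun k =>
    (mollifier E k).normed μ ⋆[.lsmul ℝ ℝ, μ] fun y => ‖g y‖ with hm
  -- A Scheffé argument: d ≤ (m - ‖g‖) + h, where m - ‖g‖ has integral zero and h is dominated by
  -- 4‖g‖ and tends to 0 a.e. The mollified norms m themselves have no evident dominating function.
  set h : ℕ → E → ℝ := fun k x =>
    2 * max (‖g x‖ - m k x) 0 + min (d k x) (2 * ‖g x‖) with hh
  have hdi : ∀ k, Integrable (d k) μ := fun k => ((integrable_mollify hg k).sub hg).norm
  have hmi : ∀ k, Integrable (m k) μ := fun k => integrable_mollify hg.norm k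
  have hhi : ∀ k, Integrable (h k) μ := fun k =>
    (((hg.norm.sub (hmi k)).pos_part).const_mul 2).add ((hdi k).inf (hg.norm.const_mul 2))
  have hm0 : ∀ k x, 0 ≤ m k x := fun k x => (norm_nonneg _).trans (norm_mollify_le g k x)
  have hdm : ∀ k x, d k x ≤ m k x + ‖g x‖ := fun k x =>
    (norm_sub_le _ _).trans (by gcongr; exact norm_mollify_le g k x)
  have hlim : Tendsto (fun k => ∫ x, h k x ∂μ) atTop (𝓝 (∫ _, (0 : ℝ) ∂μ)) := by
    refine tendsto_integral_of_dominated_convergence (fun x => 4 * ‖g x‖)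
      (fun k => (hhi k).1) (hg.norm.const_mul 4) (fun k => .of_forall fun x => ?_) ?_
    · have h1 : 0 ≤ d k x := norm_nonneg _
      have h2 := norm_nonneg (g x)
      have h3 := hm0 k x
      have h4 : max (‖g x‖ - m k x) 0 ≤ ‖g x‖ := max_le (by linarith) h2
      have h5 : 0 ≤ max (‖g x‖ - m k x) 0 := le_max_right _ _
      have h6 : min (d k x) (2 * ‖g x‖) ≤ 2 * ‖g x‖ := min_le_right _ _
      have h7 : 0 ≤ min (d k x) (2 * ‖g x‖) := le_min h1 (by linarith)
      rw [Real.norm_of_nonneg (by positivity)]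
      simp only [hh]
      linarith
    · filter_upwards [ae_tendsto_mollify hg.locallyIntegrable,
        ae_tendsto_mollify hg.norm.locallyIntegrable] with x hx1 hx2
      have e1 : Tendsto (fun k => max (‖g x‖ - m k x) 0) atTop (𝓝 0) := by
        have := (hx2.const_sub ‖g x‖).max (tendsto_const_nhds (x := (0 : ℝ)))
        simpa using this
      have e2 : Tendsto (fun k => min (d k x) (2 * ‖g x‖)) atTop (𝓝 0) := by
        have := ((hx1.sub_const (g x)).norm).min (tendsto_const_nhds (x := 2 * ‖g x‖))
        simpa using this
      simpa [hh] using (e1.const_mul 2).add e2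
  rw [integral_zero] at hlim
  have hsi : ∀ k, Integrable (fun x => m k x - ‖g x‖) μ := fun k => (hmi k).sub hg.norm
  refine squeeze_zero (fun k => integral_nonneg fun x => norm_nonneg _) (fun k => ?_) hlim
  calc ∫ x, d k x ∂μ ≤ ∫ x, ((m k x - ‖g x‖) + h k x) ∂μ := by
        refine integral_mono (hdi k) ((hsi k).add (hhi k)) fun x => ?_
        have h1 : 0 ≤ d k x := norm_nonneg _
        have h3 := hdm k x
        simp only [hh]
        rcases le_total (‖g x‖ - m k x) 0 with h4 | h4 <;>
        rcases le_total (d k x) (2 * ‖g x‖) with h5 | h5 <;>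
        simp only [h4, h5, max_eq_left, max_eq_right, min_eq_left, min_eq_right] <;> linarith
    _ = ∫ x, h k x ∂μ := by
        rw [integral_add (hsi k) (hhi k), integral_sub (hmi k) hg.norm,
          integral_mollify_norm hg k, sub_self, zero_add]

/-- The mollification of a function with a weak directional derivative is differentiable, and its
derivative is the mollification of the weak derivative. -/
theorem fderiv_mollify {F g : E → ℂ} (hF : Integrable F μ) (e : E)
    (hw : ∀ φ : E → ℝ, ContDiff ℝ ∞ φ → HasCompactSupport φ →
      ∫ x, ((fderiv ℝ φ x e : ℝ) : ℂ) * F x ∂μ = - ∫ x, ((φ x : ℝ) : ℂ) * g x ∂μ)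
    (k : ℕ) (x : E) :
    fderiv ℝ ((mollifier E k).normed μ ⋆[.lsmul ℝ ℝ, μ] F) x e
      = ((mollifier E k).normed μ ⋆[.lsmul ℝ ℝ, μ] g) x := by
  set ρ := (mollifier E k).normed μ with hρ
  have hρc : HasCompactSupport ρ := (mollifier E k).hasCompactSupport_normed
  have hρs : ContDiff ℝ ∞ ρ := (mollifier E k).contDiff_normed
  have hD := HasCompactSupport.hasFDerivAt_convolution_left (.lsmul ℝ ℝ) hρc
    (hρs.of_le (by simp)) hF.locallyIntegrable x
  have hex : ConvolutionExistsAt (fderiv ℝ ρ) F x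
      (ContinuousLinearMap.precompL E (.lsmul ℝ ℝ : ℝ →L[ℝ] ℂ →L[ℝ] ℂ)) μ :=
    (hρc.fderiv ℝ).convolutionExists_left _ (hρs.continuous_fderiv (by simp))
      hF.locallyIntegrable x
  rw [hD.fderiv, convolution_eq_swap, convolution_eq_swap,
    ContinuousLinearMap.integral_apply hex.integrable_swap]
  -- The translated and reflected kernel is the test function; the reflection supplies the sign that
  -- cancels the one in the weak derivative.
  have hφ := hw (fun y => ρ (x - y)) (hρs.comp (contDiff_const.sub contDiff_id))
    (hρc.comp_homeomorph (Homeomorph.subLeft x))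
  have hder : ∀ y, fderiv ℝ (fun y => ρ (x - y)) y e = - fderiv ℝ ρ (x - y) e := by
    intro y
    have h1 : HasFDerivAt ρ (fderiv ℝ ρ (x - y)) (x - y) :=
      (hρs.differentiable (by simp) _).hasFDerivAt
    have h2 : HasFDerivAt (fun y => ρ (x - y))
        ((fderiv ℝ ρ (x - y)).comp (-ContinuousLinearMap.id ℝ E)) y :=
      h1.comp y ((hasFDerivAt_id y).const_sub x)
    rw [h2.fderiv]
    simp
  simp only [hder, Complex.ofReal_neg, neg_mul, integral_neg, neg_inj] at hφ
  simpa [ContinuousLinearMap.precompL] using hφ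

/-- The chain rule for weak directional derivatives of integrable functions. -/
theorem integral_fderiv_mul_comp {F g : E → ℂ} (hF : Integrable F μ) (hg : Integrable g μ) (e : E)
    (hw : ∀ φ : E → ℝ, ContDiff ℝ ∞ φ → HasCompactSupport φ →
      ∫ x, ((fderiv ℝ φ x e : ℝ) : ℂ) * F x ∂μ = - ∫ x, ((φ x : ℝ) : ℂ) * g x ∂μ)
    {Θ : ℂ → ℂ} (hΘ : ContDiff ℝ ∞ Θ) (hΘc : HasCompactSupport Θ)
    {φ : E → ℝ} (hφ : ContDiff ℝ ∞ φ) (hφc : HasCompactSupport φ) :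
    ∫ x, ((fderiv ℝ φ x e : ℝ) : ℂ) * Θ (F x) ∂μ
      = - ∫ x, ((φ x : ℝ) : ℂ) * fderiv ℝ Θ (F x) (g x) ∂μ := by
  obtain ⟨C, hC⟩ := hΘc.exists_bound_of_continuous hΘ.continuous
  have hΘ' : Continuous (fderiv ℝ Θ) := hΘ.continuous_fderiv (by simp)
  obtain ⟨C', hC'⟩ := (hΘc.fderiv ℝ).exists_bound_of_continuous hΘ'
  obtain ⟨B, hB⟩ := hφc.exists_bound_of_continuous hφ.continuous
  have hC'0 : 0 ≤ C' := (norm_nonneg _).trans (hC' 0)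
  have hB0 : 0 ≤ B := (norm_nonneg _).trans (hB 0)
  have hev : Continuous fun q : ℂ × ℂ => fderiv ℝ Θ q.1 q.2 :=
    (hΘ'.comp continuous_fst).clm_apply continuous_snd
  set Fk : ℕ → E → ℂ := fun k => (mollifier E k).normed μ ⋆[.lsmul ℝ ℝ, μ] F with hFk
  set gk : ℕ → E → ℂ := fun k => (mollifier E k).normed μ ⋆[.lsmul ℝ ℝ, μ] g with hgk
  have hρc : ∀ k, HasCompactSupport ((mollifier E k).normed μ) := fun k =>
    (mollifier E k).hasCompactSupport_normed
  have hρs : ∀ k, ContDiff ℝ ∞ ((mollifier E k).normed μ) := fun k =>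
    (mollifier E k).contDiff_normed
  have hFs : ∀ k, ContDiff ℝ ∞ (Fk k) := fun k =>
    (hρc k).contDiff_convolution_left _ (hρs k) hF.locallyIntegrable
  have hgc : ∀ k, Continuous (gk k) := fun k =>
    (hρc k).continuous_convolution_left _ (hρs k).continuous hg.locallyIntegrable
  have hder : ∀ k x, fderiv ℝ (fun y => Θ (Fk k y)) x e = fderiv ℝ Θ (Fk k x) (gk k x) := by
    intro k x
    have h1 : DifferentiableAt ℝ Θ (Fk k x) := hΘ.differentiable (by simp) _
    have h2 : DifferentiableAt ℝ (Fk k) x := (hFs k).differentiable (by simp) _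
    rw [show (fun y => Θ (Fk k y)) = Θ ∘ Fk k from rfl, fderiv_comp _ h1 h2]
    simp only [ContinuousLinearMap.comp_apply]
    rw [fderiv_mollify hF e hw k x]
  have hφ' : Continuous fun x => fderiv ℝ φ x e :=
    (hφ.continuous_fderiv (by simp)).clm_apply continuous_const
  have hφ'c : HasCompactSupport fun x => fderiv ℝ φ x e := hφc.fderiv_apply ℝ e
  have hΘF : ∀ k, Continuous fun x => Θ (Fk k x) := fun k => hΘ.continuous.comp (hFs k).continuous
  have hDc : ∀ k, Continuous fun x => fderiv ℝ Θ (Fk k x) (gk k x) := fun k =>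
    hev.comp ((hFs k).continuous.prodMk (hgc k))
  have hparts : ∀ k, ∫ x, φ x • fderiv ℝ Θ (Fk k x) (gk k x) ∂μ
      = - ∫ x, fderiv ℝ φ x e • Θ (Fk k x) ∂μ := by
    intro k
    have := integral_smul_fderiv_eq_neg_fderiv_smul_of_integrable (μ := μ) (f := φ)
      (g := fun x => Θ (Fk k x)) (v := e)
      ((hφ'.smul (hΘF k)).integrable_of_hasCompactSupport hφ'c.smul_right)
      (by
        simp only [hder]
        exact (hφ.continuous.smul (hDc k)).integrable_of_hasCompactSupport hφc.smul_right)
      ((hφ.continuous.smul (hΘF k)).integrable_of_hasCompactSupport hφc.smul_right)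
      (fun x _ => hφ.differentiable (by simp) x)
      (fun x _ => (hΘ.comp (hFs k)).differentiable (by simp) x)
    simpa only [hder] using this
  have hFlim := ae_tendsto_mollify hF.locallyIntegrable
  have hlim1 : Tendsto (fun k => ∫ x, fderiv ℝ φ x e • Θ (Fk k x) ∂μ) atTop
      (𝓝 (∫ x, fderiv ℝ φ x e • Θ (F x) ∂μ)) := by
    refine tendsto_integral_of_dominated_convergence (fun x => ‖fderiv ℝ φ x e‖ * C)
      (fun k => (hφ'.smul (hΘF k)).aestronglyMeasurable)
      ((hφ'.integrable_of_hasCompactSupport hφ'c).norm.mul_const C)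
      (fun k => .of_forall fun x => ?_) ?_
    · rw [norm_smul]
      gcongr
      exact hC _
    · filter_upwards [hFlim] with x hx
      exact ((hΘ.continuous.tendsto _).comp hx).const_smul _
  -- Split DΘ(F_k)[g_k] as DΘ(F_k)[g] + DΘ(F_k)[g_k - g]: the first converges by domination, the
  -- second vanishes because g_k → g in L¹ and DΘ is bounded.
  have hlim2 : Tendsto (fun k => ∫ x, φ x • fderiv ℝ Θ (Fk k x) (g x) ∂μ) atTop
      (𝓝 (∫ x, φ x • fderiv ℝ Θ (F x) (g x) ∂μ)) := by
    refine tendsto_integral_of_dominated_convergence (fun x => B * (C' * ‖g x‖))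
      (fun k => hφ.continuous.aestronglyMeasurable.smul
        (hev.comp_aestronglyMeasurable ((hFs k).continuous.aestronglyMeasurable.prodMk hg.1)))
      ((hg.norm.const_mul C').const_mul B) (fun k => .of_forall fun x => ?_) ?_
    · rw [norm_smul]
      gcongr
      · exact hB _
      · exact (fderiv ℝ Θ (Fk k x)).le_of_opNorm_le (hC' _) _
    · filter_upwards [hFlim] with x hx
      exact ((hev.tendsto (F x, g x)).comp (hx.prodMk_nhds tendsto_const_nhds)).const_smul _
  have hlim3 : Tendsto (fun k => ∫ x, φ x • fderiv ℝ Θ (Fk k x) (gk k x - g x) ∂μ) atTop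
      (𝓝 0) := by
    have hz := (tendsto_integral_norm_mollify_sub hg).const_mul (B * C')
    rw [mul_zero] at hz
    refine squeeze_zero_norm (fun k => ?_) hz
    rw [← integral_const_mul]
    refine norm_integral_le_of_norm_le (((integrable_mollify hg k).sub hg).norm.const_mul _)
      (.of_forall fun x => ?_)
    rw [norm_smul, mul_assoc]
    gcongr
    · exact hB _
    · exact (fderiv ℝ Θ (Fk k x)).le_of_opNorm_le (hC' _) _
  have hint : ∀ k (h : E → ℂ), Integrable h μ →
      Integrable (fun x => φ x • fderiv ℝ Θ (Fk k x) (h x)) μ := by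
    intro k h hh
    refine ((hh.norm.const_mul C').const_mul B).mono' (hφ.continuous.aestronglyMeasurable.smul
        (hev.comp_aestronglyMeasurable ((hFs k).continuous.aestronglyMeasurable.prodMk hh.1)))
      (.of_forall fun x => ?_)
    rw [norm_smul]
    gcongr
    · exact hB _
    · exact (fderiv ℝ Θ (Fk k x)).le_of_opNorm_le (hC' _) _
  have hlim4 : Tendsto (fun k => ∫ x, φ x • fderiv ℝ Θ (Fk k x) (gk k x) ∂μ) atTop
      (𝓝 (∫ x, φ x • fderiv ℝ Θ (F x) (g x) ∂μ)) := by
    have := hlim3.add hlim2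
    rw [zero_add] at this
    refine this.congr fun k => ?_
    have hsub : Integrable (fun x => gk k x - g x) μ := (integrable_mollify hg k).sub hg
    rw [← integral_add (hint k _ hsub) (hint k _ hg)]
    simp only [← smul_add, ← map_add, sub_add_cancel]
  have := tendsto_nhds_unique hlim4 ((hlim1.neg).congr fun k => (hparts k).symm)
  simp only [Complex.real_smul] at this
  rw [this, neg_neg]

end Mollification

/-! ### Weak gradients: localization, chain rule, uniqueness, vanishing on the zero set. -/

section WeakGradient

open Filter Topology Set

/-- A compact subset of an open set admits a smooth cutoff function supported in the open set. -/
theorem exists_contDiff_cutoff {E : Type*} [NormedAddCommGroup E] [NormedSpace ℝ E]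
    [FiniteDimensional ℝ E] {K Ω : Set E} (hK : IsCompact K) (hΩ : IsOpen Ω) (hKΩ : K ⊆ Ω) :
    ∃ η : E → ℝ, ContDiff ℝ ∞ η ∧ HasCompactSupport η ∧ tsupport η ⊆ Ω ∧
      ∀ x ∈ K, ∀ᶠ y in 𝓝 x, η y = 1 := by
  obtain ⟨L, hL, hKL, hLΩ⟩ := exists_compact_between hK hΩ hKΩ
  obtain ⟨η, h1, h0, -⟩ := exists_contMDiffMap_one_nhds_of_subset_interior (n := ⊤)
    (modelWithCornersSelf ℝ E) hK.isClosed hKL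
  have hsupp : tsupport η ⊆ L := closure_minimal
    (fun x hx => by_contra fun hxL => hx (h0 x hxL)) hL.isClosed
  exact ⟨η, η.contMDiff.contDiff, hL.of_isClosed_subset (isClosed_tsupport _) hsupp,
    hsupp.trans hLΩ, fun x hx => h1.filter_mono (nhds_le_nhdsSet hx)⟩

variable {n : ℕ} {Ω : Set (EuclideanSpace ℝ (Fin n))} {f : EuclideanSpace ℝ (Fin n) → ℂ}
  {G : EuclideanSpace ℝ (Fin n) → EuclideanSpace ℂ (Fin n)}

theorem norm_toLp_clm_apply_le (L : ℂ →L[ℝ] ℂ) (w : EuclideanSpace ℂ (Fin n)) :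
    ‖(WithLp.toLp 2 fun i => L (w i) : EuclideanSpace ℂ (Fin n))‖ ≤ ‖L‖ * ‖w‖ := by
  rw [EuclideanSpace.norm_eq, EuclideanSpace.norm_eq, ← Real.sqrt_sq (norm_nonneg L),
    ← Real.sqrt_mul (sq_nonneg _), Finset.mul_sum]
  refine Real.sqrt_le_sqrt (Finset.sum_le_sum fun i _ => ?_)
  rw [← mul_pow]
  exact pow_le_pow_left₀ (norm_nonneg _) (L.le_opNorm _) 2

theorem aestronglyMeasurable_toLp_fderiv_apply {ν : Measure (EuclideanSpace ℝ (Fin n))}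
    {Θ : ℂ → ℂ} (hΘ : ContDiff ℝ ∞ Θ) (hf : AEStronglyMeasurable f ν)
    (hG : AEStronglyMeasurable G ν) :
    AEStronglyMeasurable (fun x => (WithLp.toLp 2 fun i => fderiv ℝ Θ (f x) (G x i) :
      EuclideanSpace ℂ (Fin n))) ν := by
  have hc : Continuous fun q : ℂ × EuclideanSpace ℂ (Fin n) =>
      (WithLp.toLp 2 fun i => fderiv ℝ Θ q.1 (q.2 i) : EuclideanSpace ℂ (Fin n)) := by
    refine (PiLp.continuous_toLp 2 _).comp (continuous_pi fun i => ?_)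
    exact ((hΘ.continuous_fderiv (by simp)).comp continuous_fst).clm_apply
      ((EuclideanSpace.proj i : EuclideanSpace ℂ (Fin n) →L[ℂ] ℂ).continuous.comp continuous_snd)
  exact hc.comp_aestronglyMeasurable (hf.prodMk hG)

theorem HasWeakGradient.locallyIntegrableOn_apply (h : HasWeakGradient Ω f G) (hΩ : IsOpen Ω)
    (i : Fin n) : LocallyIntegrableOn (fun x => G x i) Ω volume := by
  rw [locallyIntegrableOn_iff hΩ.isLocallyClosed]
  intro K hK hKc
  exact (EuclideanSpace.proj i : EuclideanSpace ℂ (Fin n) →L[ℂ] ℂ).integrable_comp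
    (h.locallyIntegrableOn_grad.integrableOn_compact_subset hK hKc)

theorem integrable_ofReal_mul_of_compact {K : Set (EuclideanSpace ℝ (Fin n))} (hK : IsCompact K)
    (hKΩ : K ⊆ Ω) {a : EuclideanSpace ℝ (Fin n) → ℝ} {g : EuclideanSpace ℝ (Fin n) → ℂ}
    (ha : Continuous a) (ha0 : ∀ x ∉ K, a x = 0) (hg : LocallyIntegrableOn g Ω volume) :
    Integrable fun x => (a x : ℂ) * g x := by
  have h1 : IntegrableOn (fun x => (a x : ℂ) * g x) K :=
    (hg.integrableOn_compact_subset hKΩ hK).continuousOn_mul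
      (Complex.continuous_ofReal.comp ha).continuousOn hK
  exact (integrableOn_iff_integrable_of_support_subset fun x hx =>
    by_contra fun hxs => hx (by simp [ha0 x hxs])).1 h1

/-- Multiplication by a smooth cutoff function turns a local weak derivative into a global one. -/
theorem HasWeakGradient.integral_cutoff (h : HasWeakGradient Ω f G) (hΩ : IsOpen Ω)
    {η : EuclideanSpace ℝ (Fin n) → ℝ} (hη : ContDiff ℝ ∞ η) (hηc : HasCompactSupport η)
    (hηΩ : tsupport η ⊆ Ω) (i : Fin n) :
    Integrable (fun x => (η x : ℂ) * f x) ∧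
    Integrable (fun x => (η x : ℂ) * G x i
      + ((fderiv ℝ η x (EuclideanSpace.single i 1) : ℝ) : ℂ) * f x) ∧
    ∀ φ : EuclideanSpace ℝ (Fin n) → ℝ, ContDiff ℝ ∞ φ → HasCompactSupport φ →
      ∫ x, ((fderiv ℝ φ x (EuclideanSpace.single i 1) : ℝ) : ℂ) * ((η x : ℂ) * f x)
        = - ∫ x, (φ x : ℂ) * ((η x : ℂ) * G x i
          + ((fderiv ℝ η x (EuclideanSpace.single i 1) : ℝ) : ℂ) * f x) := by
  set e : EuclideanSpace ℝ (Fin n) := EuclideanSpace.single i 1 with he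
  have hη' : Continuous fun x => fderiv ℝ η x e :=
    (hη.continuous_fderiv (by simp)).clm_apply continuous_const
  have hη's : ∀ x ∉ tsupport η, fderiv ℝ η x = 0 := fun x hx =>
    image_eq_zero_of_notMem_tsupport fun h => hx (tsupport_fderiv_subset ℝ h)
  have key : ∀ (a : EuclideanSpace ℝ (Fin n) → ℝ) (g : EuclideanSpace ℝ (Fin n) → ℂ),
      Continuous a → (∀ x ∉ tsupport η, a x = 0) → LocallyIntegrableOn g Ω volume →
      Integrable fun x => (a x : ℂ) * g x := fun a g ha ha0 hg =>
    integrable_ofReal_mul_of_compact hηc hηΩ ha ha0 hg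
  have hη0 : ∀ x ∉ tsupport η, η x = 0 := fun x hx => image_eq_zero_of_notMem_tsupport hx
  have hGi := h.locallyIntegrableOn_apply hΩ i
  have i1 := key η f hη.continuous hη0 h.locallyIntegrableOn
  have i2 := key η _ hη.continuous hη0 hGi
  have i3 := key (fun x => fderiv ℝ η x e) f hη' (fun x hx => by simp [hη's x hx])
    h.locallyIntegrableOn
  refine ⟨i1, i2.add i3, fun φ hφ hφc => ?_⟩
  have hφ' : Continuous fun x => fderiv ℝ φ x e :=
    (hφ.continuous_fderiv (by simp)).clm_apply continuous_const
  have hts : tsupport (fun x => φ x * η x) ⊆ tsupport η := tsupport_mul_subset_right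
  have hder : ∀ x, fderiv ℝ (fun x => φ x * η x) x e
      = φ x * fderiv ℝ η x e + fderiv ℝ φ x e * η x := by
    intro x
    rw [fderiv_fun_mul (hφ.differentiable (by simp) x) (hη.differentiable (by simp) x)]
    simp [mul_comm]
  -- The product φη is a test function supported in Ω, and the Leibniz rule distributes its
  -- derivative over the two sides.
  have hI := h.integral_eq (fun x => φ x * η x) (hφ.mul hη) hηc.mul_left (hts.trans hηΩ) i
  rw [setIntegral_eq_integral_of_forall_compl_eq_zero,
    setIntegral_eq_integral_of_forall_compl_eq_zero] at hI
  rotate_left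
  · intro x hx
    simp [hη0 x fun h => hx (hηΩ h)]
  · intro x hx
    have hx' : x ∉ tsupport η := fun h => hx (hηΩ h)
    rw [← he, hder]
    simp [hη0 x hx', hη's x hx']
  simp only [← he, hder] at hI
  have j1 : Integrable fun x => ((φ x * fderiv ℝ η x e : ℝ) : ℂ) * f x :=
    key (fun x => φ x * fderiv ℝ η x e) f (hφ.continuous.mul hη')
      (fun x hx => by simp [hη's x hx]) h.locallyIntegrableOn
  have j2 : Integrable fun x => ((fderiv ℝ φ x e * η x : ℝ) : ℂ) * f x :=
    key (fun x => fderiv ℝ φ x e * η x) f (hφ'.mul hη.continuous)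
      (fun x hx => by simp [hη0 x hx]) h.locallyIntegrableOn
  have j3 : Integrable fun x => ((φ x * η x : ℝ) : ℂ) * G x i :=
    key (fun x => φ x * η x) _ (hφ.continuous.mul hη.continuous)
      (fun x hx => by simp [hη0 x hx]) hGi
  have e1 : (fun x => (φ x : ℂ) * ((η x : ℂ) * G x i + ((fderiv ℝ η x e : ℝ) : ℂ) * f x))
      = fun x => ((φ x * η x : ℝ) : ℂ) * G x i + ((φ x * fderiv ℝ η x e : ℝ) : ℂ) * f x := by
    funext x; push_cast; ring
  have e2 : (fun x => ((φ x * fderiv ℝ η x e + fderiv ℝ φ x e * η x : ℝ) : ℂ) * f x)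
      = fun x => ((φ x * fderiv ℝ η x e : ℝ) : ℂ) * f x
        + ((fderiv ℝ φ x e * η x : ℝ) : ℂ) * f x := by
    funext x; push_cast; ring
  have e3 : (fun x => ((fderiv ℝ φ x e : ℝ) : ℂ) * ((η x : ℂ) * f x))
      = fun x => ((fderiv ℝ φ x e * η x : ℝ) : ℂ) * f x := by
    funext x; push_cast; ring
  rw [e2, integral_add j1 j2] at hI
  rw [e1, e3, integral_add j3 j1]
  linear_combination hI

/-- The chain rule for weak gradients and smooth, compactly supported outer functions. -/
theorem HasWeakGradient.comp (h : HasWeakGradient Ω f G) (hΩ : IsOpen Ω)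
    {Θ : ℂ → ℂ} (hΘ : ContDiff ℝ ∞ Θ) (hΘc : HasCompactSupport Θ) :
    HasWeakGradient Ω (fun x => Θ (f x))
      (fun x => WithLp.toLp 2 fun i => fderiv ℝ Θ (f x) (G x i)) := by
  obtain ⟨C, hC⟩ := hΘc.exists_bound_of_continuous hΘ.continuous
  obtain ⟨C', hC'⟩ := (hΘc.fderiv ℝ).exists_bound_of_continuous (hΘ.continuous_fderiv (by simp))
  have hfm := h.locallyIntegrableOn.aestronglyMeasurable
  have hGm := h.locallyIntegrableOn_grad.aestronglyMeasurable
  refine ⟨?_, ?_, fun φ hφ hφc hφΩ i => ?_⟩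
  · rw [locallyIntegrableOn_iff hΩ.isLocallyClosed]
    intro K hK hKc
    have : IsFiniteMeasure (volume.restrict K) := ⟨by simpa using hKc.measure_lt_top⟩
    exact (integrable_const C).mono' ((hΘ.continuous.comp_aestronglyMeasurable hfm).mono_measure
      (Measure.restrict_mono_set _ hK)) (.of_forall fun x => hC _)
  · rw [locallyIntegrableOn_iff hΩ.isLocallyClosed]
    intro K hK hKc
    have hGK : IntegrableOn G K := h.locallyIntegrableOn_grad.integrableOn_compact_subset hK hKc
    exact (hGK.norm.const_mul C').mono' ((aestronglyMeasurable_toLp_fderiv_apply hΘ hfm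
      hGm).mono_measure (Measure.restrict_mono_set _ hK)) (.of_forall fun x =>
        (norm_toLp_clm_apply_le _ _).trans (by gcongr; exact hC' _))
  -- Since η = 1 near the support of φ, ηf may replace f there and the term with the derivative of η
  -- drops out.
  · obtain ⟨η, hη, hηc, hηΩ, hη1⟩ := exists_contDiff_cutoff hφc hΩ hφΩ
    obtain ⟨hF, hg, hw⟩ := h.integral_cutoff hΩ hη hηc hηΩ i
    have hmain := integral_fderiv_mul_comp hF hg _ hw hΘ hΘc hφ hφc
    have hφ0 : ∀ x ∉ tsupport φ, φ x = 0 := fun x hx => image_eq_zero_of_notMem_tsupport hx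
    have hφ's : ∀ x ∉ tsupport φ, fderiv ℝ φ x = 0 := fun x hx =>
      image_eq_zero_of_notMem_tsupport fun h => hx (tsupport_fderiv_subset ℝ h)
    rw [setIntegral_eq_integral_of_forall_compl_eq_zero
        (fun x hx => by simp [hφ's x fun h => hx (hφΩ h)]),
      setIntegral_eq_integral_of_forall_compl_eq_zero
        (fun x hx => by simp [hφ0 x fun h => hx (hφΩ h)])]
    refine (integral_congr_ae (.of_forall fun x => ?_)).trans (hmain.trans
      (congrArg Neg.neg (integral_congr_ae (.of_forall fun x => ?_))))
    · by_cases hx : x ∈ tsupport φ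
      · simp [(hη1 x hx).self_of_nhds]
      · simp [hφ's x hx]
    · by_cases hx : x ∈ tsupport φ
      · have h1 : η =ᶠ[𝓝 x] fun _ => 1 := hη1 x hx
        simp [h1.fderiv_eq, h1.self_of_nhds]
      · simp [hφ0 x hx]

/-- Weak gradients are unique up to null sets. -/
theorem HasWeakGradient.ae_eq {G' : EuclideanSpace ℝ (Fin n) → EuclideanSpace ℂ (Fin n)}
    (h : HasWeakGradient Ω f G) (h' : HasWeakGradient Ω f G') (hΩ : IsOpen Ω) :
    ∀ᵐ x ∂(volume.restrict Ω), G x = G' x := by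
  rw [ae_restrict_iff' hΩ.measurableSet]
  have key : ∀ i, ∀ᵐ x, x ∈ Ω → G x i - G' x i = 0 := by
    intro i
    refine hΩ.ae_eq_zero_of_integral_contDiff_smul_eq_zero
      ((h.locallyIntegrableOn_apply hΩ i).sub (h'.locallyIntegrableOn_apply hΩ i))
      fun φ hφ hφc hφΩ => ?_
    have e1 := h.integral_eq φ hφ hφc hφΩ i
    have e2 := h'.integral_eq φ hφ hφc hφΩ i
    have int : ∀ g : EuclideanSpace ℝ (Fin n) → ℂ, LocallyIntegrableOn g Ω volume →
        IntegrableOn (fun x => (φ x : ℂ) * g x) Ω := fun g hg =>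
      (integrable_ofReal_mul_of_compact hφc hφΩ hφ.continuous
        (fun x hx => image_eq_zero_of_notMem_tsupport hx) hg).integrableOn
    rw [← setIntegral_eq_integral_of_forall_compl_eq_zero (s := Ω) (fun x hx => by
      simp [image_eq_zero_of_notMem_tsupport fun h => hx (hφΩ h)])]
    simp only [Complex.real_smul, mul_sub]
    rw [integral_sub (int _ (h.locallyIntegrableOn_apply hΩ i))
      (int _ (h'.locallyIntegrableOn_apply hΩ i))]
    rw [sub_eq_zero, ← neg_inj, ← e1, e2]
  filter_upwards [ae_all_iff.2 key] with x hx hxΩ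
  ext i
  exact sub_eq_zero.1 (hx i hxΩ)

/-- The weak gradient vanishes almost everywhere on the zero set. -/
theorem HasWeakGradient.ae_eq_zero (h : HasWeakGradient Ω f G) (hΩ : IsOpen Ω) :
    ∀ᵐ x ∂(volume.restrict Ω), f x = 0 → G x = 0 := by
  -- Θ is the identity near 0 and has compact support. Then Θ((k+1)f)/(k+1) tends to 0 uniformly,
  -- while its gradient DΘ((k+1)f)[G] tends to G on {f = 0} and to 0 elsewhere. So G restricted to
  -- {f = 0} is a weak gradient of 0.
  let b : ContDiffBump (0 : ℂ) := ⟨1, 2, one_pos, one_lt_two⟩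
  let Θ : ℂ → ℂ := fun z => b z • z
  have hΘ : ContDiff ℝ ∞ Θ := b.contDiff.smul contDiff_id
  have hΘc : HasCompactSupport Θ := b.hasCompactSupport.smul_right
  have hΘ' : Continuous (fderiv ℝ Θ) := hΘ.continuous_fderiv (by simp)
  obtain ⟨C, hC⟩ := hΘc.exists_bound_of_continuous hΘ.continuous
  obtain ⟨C', hC'⟩ := (hΘc.fderiv ℝ).exists_bound_of_continuous hΘ'
  have hD0 : fderiv ℝ Θ 0 = ContinuousLinearMap.id ℝ ℂ := by
    have : Θ =ᶠ[𝓝 0] id := by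
      filter_upwards [b.eventuallyEq_one] with z hz
      simp [Θ, hz]
    rw [this.fderiv_eq, fderiv_id]
  have hDlim : ∀ z : ℂ, z ≠ 0 →
      Tendsto (fun k : ℕ => fderiv ℝ Θ (((k : ℝ) + 1) • z)) atTop (𝓝 0) := by
    intro z hz
    have hlarge : Tendsto (fun k : ℕ => ((k : ℝ) + 1) * ‖z‖) atTop atTop :=
      (tendsto_atTop_add_const_right _ _ tendsto_natCast_atTop_atTop).atTop_mul_const
        (norm_pos_iff.2 hz)
    refine tendsto_const_nhds.congr' ?_
    filter_upwards [hlarge.eventually_gt_atTop 2] with k hk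
    refine (image_eq_zero_of_notMem_tsupport fun hmem => ?_).symm
    have hm : ((k : ℝ) + 1) • z ∈ tsupport b :=
      (tsupport_smul_subset_left _ _) (tsupport_fderiv_subset ℝ hmem)
    rw [b.tsupport_eq, mem_closedBall_zero_iff, norm_smul,
      Real.norm_of_nonneg (by positivity)] at hm
    exact absurd hm (not_le.2 hk)
  have hfm := h.locallyIntegrableOn.aestronglyMeasurable
  have hzero : ∀ i, ∀ᵐ x, x ∈ Ω → (if f x = 0 then G x i else 0) = 0 := by
    intro i
    have hGi := h.locallyIntegrableOn_apply hΩ i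
    have hm : AEStronglyMeasurable (fun x => if f x = 0 then G x i else 0)
        (volume.restrict Ω) := by
      have h0 : NullMeasurableSet {x | f x = 0} (volume.restrict Ω) :=
        hfm.nullMeasurableSet_eq_fun aestronglyMeasurable_const
      exact (hGi.aestronglyMeasurable.indicator₀ h0).congr
        (.of_forall fun x => by simp [indicator_apply])
    refine hΩ.ae_eq_zero_of_integral_contDiff_smul_eq_zero ?_ fun φ hφ hφc hφΩ => ?_
    · rw [locallyIntegrableOn_iff hΩ.isLocallyClosed]
      intro K hK hKc
      refine (hGi.integrableOn_compact_subset hK hKc).norm.mono'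
        (hm.mono_measure (Measure.restrict_mono_set _ hK)) (.of_forall fun x => ?_)
      split_ifs <;> simp
    · have hφ0 : ∀ x ∉ tsupport φ, φ x = 0 := fun x hx => image_eq_zero_of_notMem_tsupport hx
      have hφG : IntegrableOn (fun x => (φ x : ℂ) * G x i) Ω :=
        (integrable_ofReal_mul_of_compact hφc hφΩ hφ.continuous hφ0 hGi).integrableOn
      have hφ' : Continuous fun x => fderiv ℝ φ x (EuclideanSpace.single i 1) :=
        (hφ.continuous_fderiv (by simp)).clm_apply continuous_const
      have hφ'i : Integrable fun x => fderiv ℝ φ x (EuclideanSpace.single i 1) :=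
        hφ'.integrable_of_hasCompactSupport (hφc.fderiv_apply ℝ _)
      have hk : ∀ k : ℕ, ∫ x in Ω, (φ x : ℂ) * fderiv ℝ Θ (((k : ℝ) + 1) • f x) (G x i)
          = - ((1 / ((k : ℝ) + 1) : ℝ) * ∫ x in Ω,
            ((fderiv ℝ φ x (EuclideanSpace.single i 1) : ℝ) : ℂ)
              * Θ (((k : ℝ) + 1) • f x)) := by
        intro k
        have hk0 : ((k : ℝ) + 1) ≠ 0 := by positivity
        have hs : ContDiff ℝ ∞ fun z => Θ (((k : ℝ) + 1) • z) :=
          hΘ.comp (contDiff_id.const_smul _)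
        have hsc : HasCompactSupport fun z => Θ (((k : ℝ) + 1) • z) :=
          hΘc.comp_homeomorph (Homeomorph.smulOfNeZero _ hk0)
        have := (h.comp hΩ hs hsc).integral_eq φ hφ hφc hφΩ i
        have hd : ∀ z w, fderiv ℝ (fun z => Θ (((k : ℝ) + 1) • z)) z w
            = (((k : ℝ) + 1 : ℝ) : ℂ) * fderiv ℝ Θ (((k : ℝ) + 1) • z) w := by
          intro z w
          have h1 : HasFDerivAt Θ (fderiv ℝ Θ (((k : ℝ) + 1) • z)) (((k : ℝ) + 1) • z) :=
            (hΘ.differentiable (by simp) _).hasFDerivAt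
          have h2 : HasFDerivAt (fun z => Θ (((k : ℝ) + 1) • z))
              ((fderiv ℝ Θ (((k : ℝ) + 1) • z)).comp
                (((k : ℝ) + 1) • ContinuousLinearMap.id ℝ ℂ)) z :=
            h1.comp z ((hasFDerivAt_id z).const_smul ((k : ℝ) + 1))
          rw [h2.fderiv]
          rw [← Complex.real_smul, ← map_smul]
          rfl
        simp only [hd, mul_left_comm _ (((k : ℝ) + 1 : ℝ) : ℂ), integral_const_mul] at this
        rw [this]
        have : (((k : ℝ) + 1 : ℝ) : ℂ) ≠ 0 := by exact_mod_cast hk0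
        push_cast at this ⊢
        field_simp
      have hL : Tendsto (fun k : ℕ => ∫ x in Ω, (φ x : ℂ)
          * fderiv ℝ Θ (((k : ℝ) + 1) • f x) (G x i)) atTop
          (𝓝 (∫ x in Ω, (φ x : ℂ) * if f x = 0 then G x i else 0)) := by
        refine tendsto_integral_of_dominated_convergence (fun x => C' * ‖(φ x : ℂ) * G x i‖)
          (fun k => ?_) (hφG.norm.const_mul C') (fun k => .of_forall fun x => ?_)
          (.of_forall fun x => ?_)
        · have hc : Continuous fun q : ℂ × ℂ => fderiv ℝ Θ (((k : ℝ) + 1) • q.1) q.2 :=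
            (hΘ'.comp (continuous_fst.const_smul ((k : ℝ) + 1))).clm_apply continuous_snd
          exact (Complex.continuous_ofReal.comp hφ.continuous).aestronglyMeasurable.mul
            (hc.comp_aestronglyMeasurable (hfm.prodMk hGi.aestronglyMeasurable))
        · rw [norm_mul, norm_mul, mul_left_comm]
          gcongr
          exact ContinuousLinearMap.le_of_opNorm_le _ (hC' _) _
        · refine Tendsto.const_mul _ ?_
          split_ifs with hx
          · simp [hx, hD0]
          · have := ((ContinuousLinearMap.apply ℝ ℂ (G x i)).continuous.tendsto 0).comp
              (hDlim (f x) hx)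
            rw [map_zero] at this
            exact this
      have hR : Tendsto (fun k : ℕ => - ((1 / ((k : ℝ) + 1) : ℝ) * ∫ x in Ω,
            ((fderiv ℝ φ x (EuclideanSpace.single i 1) : ℝ) : ℂ)
              * Θ (((k : ℝ) + 1) • f x))) atTop (𝓝 0) := by
        have hz := (tendsto_one_div_add_atTop_nhds_zero_nat (𝕜 := ℝ)).mul_const
          (∫ x in Ω, ‖fderiv ℝ φ x (EuclideanSpace.single i 1)‖ * C)
        rw [zero_mul] at hz
        refine squeeze_zero_norm (fun k => ?_) hz
        rw [norm_neg, norm_mul, Complex.norm_real, Real.norm_of_nonneg (by positivity)]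
        gcongr
        refine norm_integral_le_of_norm_le (hφ'i.norm.mul_const C).integrableOn
          (.of_forall fun x => ?_)
        rw [norm_mul, Complex.norm_real]
        gcongr
        exact hC _
      have := tendsto_nhds_unique hL (hR.congr fun k => (hk k).symm)
      rw [← setIntegral_eq_integral_of_forall_compl_eq_zero (s := Ω) (fun x hx => by
        simp [hφ0 x fun h => hx (hφΩ h)])]
      simpa only [Complex.real_smul] using this
  rw [ae_restrict_iff' hΩ.measurableSet]
  filter_upwards [ae_all_iff.2 hzero] with x hx hxΩ hfx
  ext i
  simpa [hfx] using hx i hxΩ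

/-! ### Generalized gradients and their uniqueness. -/

theorem HasWeakGradient.hasGeneralizedGradient (h : HasWeakGradient Ω f G) (hΩ : IsOpen Ω) :
    HasGeneralizedGradient Ω f G :=
  ⟨h.locallyIntegrableOn_grad.aestronglyMeasurable, fun _ hφ hφc _ => h.comp hΩ hφ hφc,
    h.ae_eq_zero hΩ⟩

/-- Reduces both alternatives to the generalized one, so that a single uniqueness statement covers
gradients in either sense. -/
theorem HasGradient.hasGeneralizedGradient (h : HasGradient Ω f G) (hΩ : IsOpen Ω) :
    HasGeneralizedGradient Ω f G :=
  h.elim (fun h => h.hasGeneralizedGradient hΩ) id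

/-- A smooth, compactly supported function that is the identity on a large annulus about `0` and
vanishes near `0`. -/
theorem exists_contDiff_eq_id_annulus (k : ℕ) : ∃ φ : ℂ → ℂ, ContDiff ℝ ∞ φ ∧
    HasCompactSupport φ ∧ (0 : ℂ) ∉ tsupport φ ∧
    ∀ z : ℂ, 1 / ((k : ℝ) + 1) < ‖z‖ → ‖z‖ < (k : ℝ) + 1 → fderiv ℝ φ z = .id ℝ ℂ := by
  have hk : (0 : ℝ) < (k : ℝ) + 1 := by positivity
  have hk' : (0 : ℝ) < 1 / ((k : ℝ) + 1) := by positivity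
  let a : ContDiffBump (0 : ℂ) := ⟨(k : ℝ) + 1, (k : ℝ) + 2, hk, by linarith⟩
  let b : ContDiffBump (0 : ℂ) := ⟨1 / ((k : ℝ) + 1) / 2, 1 / ((k : ℝ) + 1), by positivity,
    by linarith⟩
  refine ⟨fun z => (a z * (1 - b z)) • z,
    (a.contDiff.mul (contDiff_const.sub b.contDiff)).smul contDiff_id,
    (a.hasCompactSupport.mul_right).smul_right, ?_, fun z hz1 hz2 => ?_⟩
  · rw [notMem_tsupport_iff_eventuallyEq]
    filter_upwards [b.eventuallyEq_one] with z hz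
    simp [hz]
  · have : (fun z => (a z * (1 - b z)) • z) =ᶠ[𝓝 z] id := by
      filter_upwards [continuous_norm.continuousAt.eventually (lt_mem_nhds hz1),
        continuous_norm.continuousAt.eventually (gt_mem_nhds hz2)] with w hw1 hw2
      have h1 : a w = 1 := a.one_of_mem_closedBall (by simpa using hw2.le)
      have h2 : b w = 0 := b.zero_of_le_dist (by simpa [b] using hw1.le)
      simp [h1, h2]
    rw [this.fderiv_eq, fderiv_id]

/-- Generalized gradients are unique up to null sets. -/
theorem HasGeneralizedGradient.ae_eq
    {G' : EuclideanSpace ℝ (Fin n) → EuclideanSpace ℂ (Fin n)}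
    (h : HasGeneralizedGradient Ω f G) (h' : HasGeneralizedGradient Ω f G') (hΩ : IsOpen Ω) :
    ∀ᵐ x ∂(volume.restrict Ω), G x = G' x := by
  -- Countably many test functions suffice: wherever f(x) ≠ 0, the differential of φ_k at f(x) is
  -- the identity for large k.
  choose φ hφ hφc hφ0 hφid using exists_contDiff_eq_id_annulus
  have hk : ∀ k, ∀ᵐ x ∂(volume.restrict Ω),
      (WithLp.toLp 2 fun i => fderiv ℝ (φ k) (f x) (G x i) : EuclideanSpace ℂ (Fin n))
        = WithLp.toLp 2 fun i => fderiv ℝ (φ k) (f x) (G' x i) := fun k =>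
    (h.chain_rule _ (hφ k) (hφc k) (hφ0 k)).ae_eq (h'.chain_rule _ (hφ k) (hφc k) (hφ0 k)) hΩ
  filter_upwards [ae_all_iff.2 hk, h.eq_zero, h'.eq_zero] with x hx h0 h0'
  by_cases hfx : f x = 0
  · rw [h0 hfx, h0' hfx]
  have hpos := norm_pos_iff.2 hfx
  have e1 := (tendsto_one_div_add_atTop_nhds_zero_nat (𝕜 := ℝ)).eventually (gt_mem_nhds hpos)
  have e2 := (tendsto_atTop_add_const_right atTop (1 : ℝ)
    (tendsto_natCast_atTop_atTop (R := ℝ))).eventually_gt_atTop ‖f x‖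
  obtain ⟨k, hk1, hk2⟩ := (e1.and e2).exists
  ext i
  simpa [hφid k _ hk1 hk2] using congr_arg (fun v : EuclideanSpace ℂ (Fin n) => v i) (hx k)

end WeakGradient

/-! ### Power maps and the generalized gradients of their compositions. -/

section PowerMap

open Filter Topology Set

/-- The power map `z ↦ |z|^r z`. -/
noncomputable def powMap (r : ℝ) (z : ℂ) : ℂ := (‖z‖ ^ r : ℝ) • z

/-- The differential of the power map at `z ≠ 0`, applied to `w`; it is `0` at `z = 0`. -/
noncomputable def powMapDeriv (r : ℝ) (z w : ℂ) : ℂ :=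
  if z = 0 then 0
  else (‖z‖ ^ r : ℝ) • w + (r * ‖z‖ ^ (r - 2) * inner ℝ z w : ℝ) • z

@[simp] theorem powMap_zero (r : ℝ) : powMap r 0 = 0 := by simp [powMap]

theorem norm_powMap (r : ℝ) {z : ℂ} (hz : z ≠ 0) : ‖powMap r z‖ = ‖z‖ ^ (r + 1) := by
  rw [powMap, norm_smul, Real.norm_of_nonneg (by positivity),
    Real.rpow_add (norm_pos_iff.2 hz), Real.rpow_one]

/-- `powMap r` keeps the argument and raises the modulus to the power r + 1; under composition these
exponents multiply. -/
theorem powMap_powMap (r s : ℝ) (z : ℂ) : powMap r (powMap s z) = powMap ((s + 1) * r + s) z := by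
  rcases eq_or_ne z 0 with rfl | hz
  · simp
  have h := norm_pos_iff.2 hz
  rw [powMap, norm_powMap s hz, powMap, powMap, smul_smul, ← Real.rpow_mul h.le,
    ← Real.rpow_add h]

theorem contDiffAt_powMap (r : ℝ) {z : ℂ} (hz : z ≠ 0) : ContDiffAt ℝ ∞ (powMap r) z :=
  ((contDiffAt_norm ℝ hz).rpow_const_of_ne (norm_ne_zero_iff.2 hz)).smul contDiffAt_id

theorem continuousAt_powMap_zero {r : ℝ} (hr : -1 < r) : ContinuousAt (powMap r) 0 := by
  have h : Tendsto (fun z : ℂ => ‖z‖ ^ (r + 1)) (𝓝 0) (𝓝 0) := by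
    have := (continuous_norm (E := ℂ)).continuousAt (x := 0) |>.rpow_const
      (p := r + 1) (Or.inr (by linarith))
    simpa [ContinuousAt, Real.zero_rpow (show r + 1 ≠ 0 by linarith)] using this
  rw [ContinuousAt, powMap_zero]
  refine squeeze_zero_norm (fun z => ?_) h
  rcases eq_or_ne z 0 with rfl | hz
  · simp [Real.zero_rpow (show r + 1 ≠ 0 by linarith)]
  · exact (norm_powMap r hz).le

theorem fderiv_powMap (r : ℝ) {z : ℂ} (hz : z ≠ 0) (w : ℂ) :
    fderiv ℝ (powMap r) z w = powMapDeriv r z w := by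
  have h := norm_pos_iff.2 hz
  have hsq : HasFDerivAt (fun z : ℂ => ‖z‖ ^ 2) (2 • innerSL ℝ z) z :=
    (hasStrictFDerivAt_norm_sq z).hasFDerivAt
  have h1 : HasFDerivAt (fun z : ℂ => (‖z‖ ^ 2) ^ (r / 2))
      ((r / 2 * (‖z‖ ^ 2) ^ (r / 2 - 1)) • (2 • innerSL ℝ z)) z :=
    hsq.rpow_const (Or.inl (by positivity))
  have e : ∀ (z : ℂ) (s : ℝ), (‖z‖ ^ 2) ^ (s / 2) = ‖z‖ ^ s := fun z s => by
    rw [← Real.rpow_natCast, ← Real.rpow_mul (norm_nonneg _)]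
    congr 1
    push_cast
    ring
  have h2 := h1.smul (hasFDerivAt_id z)
  have hf : (fun z : ℂ => ((‖z‖ ^ 2) ^ (r / 2)) • id z) = powMap r := by
    funext z
    rw [e, powMap, id]
  change HasFDerivAt (fun z : ℂ => ((‖z‖ ^ 2) ^ (r / 2)) • id z) _ z at h2
  rw [hf] at h2
  rw [h2.fderiv, powMapDeriv, if_neg hz, e, show r / 2 - 1 = (r - 2) / 2 by ring, e]
  simp
  exact Or.inl (by ring)

theorem measurable_powMapDeriv (r : ℝ) : Measurable fun q : ℂ × ℂ => powMapDeriv r q.1 q.2 := by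
  unfold powMapDeriv
  refine Measurable.ite (measurableSet_eq_fun measurable_fst measurable_const) measurable_const ?_
  have hn : Measurable fun q : ℂ × ℂ => ‖q.1‖ := measurable_fst.norm
  have hi : Measurable fun q : ℂ × ℂ => inner ℝ q.1 q.2 :=
    (continuous_fst.inner continuous_snd).measurable
  exact ((hn.pow_const r).smul measurable_snd).add
    (((hn.pow_const (r - 2)).const_mul r |>.mul hi).smul measurable_fst)

/-- A smooth function supported away from `0` stays so after composition with a power map. -/
theorem contDiff_comp_powMap {r : ℝ} (hr : -1 < r) {φ : ℂ → ℂ} (hφ : ContDiff ℝ ∞ φ)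
    (hφc : HasCompactSupport φ) (hφ0 : (0 : ℂ) ∉ tsupport φ) :
    ContDiff ℝ ∞ (fun z => φ (powMap r z)) ∧ HasCompactSupport (fun z => φ (powMap r z)) ∧
      (fun z => φ (powMap r z)) =ᶠ[𝓝 0] 0 := by
  -- Continuity of the power map at 0, where r > -1 enters, makes the composition vanish near its
  -- only singular point.
  have h0 : (fun z => φ (powMap r z)) =ᶠ[𝓝 0] 0 := by
    have h1 : φ =ᶠ[𝓝 (powMap r 0)] 0 := by
      rw [powMap_zero]
      exact notMem_tsupport_iff_eventuallyEq.1 hφ0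
    exact (continuousAt_powMap_zero hr).eventually h1
  refine ⟨contDiff_iff_contDiffAt.2 fun z => ?_, ?_, h0⟩
  · rcases eq_or_ne z 0 with rfl | hz
    · exact contDiffAt_const.congr_of_eventuallyEq h0
    · exact hφ.contDiffAt.comp z (contDiffAt_powMap r hz)
  · obtain ⟨R, hR⟩ := hφc.isBounded.subset_closedBall (0 : ℂ)
    have hr' : 0 < r + 1 := by linarith
    refine HasCompactSupport.of_support_subset_isCompact
      (isCompact_closedBall (0 : ℂ) (max R 0 ^ (1 / (r + 1)))) fun z hz => ?_
    rw [mem_closedBall_zero_iff]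
    rcases eq_or_ne z 0 with rfl | hz0
    · simpa using Real.rpow_nonneg (le_max_right R 0) _
    have hm : powMap r z ∈ Metric.closedBall (0 : ℂ) R := hR (subset_tsupport _ hz)
    rw [mem_closedBall_zero_iff, norm_powMap r hz0] at hm
    calc ‖z‖ = (‖z‖ ^ (r + 1)) ^ (1 / (r + 1)) := by
          rw [← Real.rpow_mul (norm_nonneg _), mul_one_div_cancel hr'.ne', Real.rpow_one]
      _ ≤ max R 0 ^ (1 / (r + 1)) :=
          Real.rpow_le_rpow (by positivity) (hm.trans (le_max_left _ _)) (by positivity)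

variable {n : ℕ} {Ω : Set (EuclideanSpace ℝ (Fin n))} {f : EuclideanSpace ℝ (Fin n) → ℂ}
  {G : EuclideanSpace ℝ (Fin n) → EuclideanSpace ℂ (Fin n)}

/-- The generalized gradient of `|f|^r f` for a weakly differentiable function `f`. -/
theorem HasWeakGradient.hasGeneralizedGradient_powMap (h : HasWeakGradient Ω f G)
    (hΩ : IsOpen Ω) {r : ℝ} (hr : -1 < r) :
    HasGeneralizedGradient Ω (fun x => powMap r (f x))
      (fun x => WithLp.toLp 2 fun i => powMapDeriv r (f x) (G x i)) := by
  refine ⟨?_, fun φ hφ hφc hφ0 => ?_, ?_⟩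
  · refine ((WithLp.measurable_toLp 2 _).comp_aemeasurable
      (aemeasurable_pi_lambda _ fun i => ?_)).aestronglyMeasurable
    exact (measurable_powMapDeriv r).comp_aemeasurable
      (h.locallyIntegrableOn.aestronglyMeasurable.aemeasurable.prodMk
        (h.locallyIntegrableOn_apply hΩ i).aestronglyMeasurable.aemeasurable)
  -- The power map is absorbed into φ: the composite is smooth with compact support, so the chain
  -- rule for f applies to it directly.
  · obtain ⟨h1, h2, h3⟩ := contDiff_comp_powMap hr hφ hφc hφ0
    convert h.comp hΩ h1 h2 using 3 with x
    funext i
    simp only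
    rcases eq_or_ne (f x) 0 with hx | hx
    · rw [hx, h3.fderiv_eq, powMapDeriv, if_pos rfl]
      simp [Pi.zero_def]
    · have e : fderiv ℝ (φ ∘ powMap r) (f x)
          = (fderiv ℝ φ (powMap r (f x))).comp (fderiv ℝ (powMap r) (f x)) :=
        fderiv_comp _ (hφ.differentiable (by simp) _)
          ((contDiffAt_powMap r hx).differentiableAt (by simp))
      rw [← fderiv_powMap r hx]
      exact (DFunLike.congr_fun e (G x i)).symm
  · refine .of_forall fun x hx => ?_
    have hfx : f x = 0 := by
      by_contra hne
      have := norm_powMap r hne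
      rw [hx, norm_zero] at this
      exact (Real.rpow_pos_of_pos (norm_pos_iff.2 hne) _).ne this
    ext i
    simp [powMapDeriv, hfx]

end PowerMap

/-! ### Pointwise algebra of the sesquilinear form. -/

section Ellipticity

variable {n : ℕ}

theorem sesqForm_smul_smul (M : Matrix (Fin n) (Fin n) ℂ) (ξ η : EuclideanSpace ℂ (Fin n))
    (a b : ℂ) : sesqForm M (a • ξ) (b • η) = a * conj b * sesqForm M ξ η := by
  simp only [sesqForm, Finset.mul_sum, PiLp.smul_apply, smul_eq_mul, map_mul]
  refine Finset.sum_congr rfl fun i _ => Finset.sum_congr rfl fun j _ => ?_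
  ring

theorem norm_Jmap_le {p : ℝ} (hp : 1 < p) (ξ : EuclideanSpace ℂ (Fin n)) :
    ‖Jmap p ξ‖ ≤ ‖ξ‖ := by
  rw [EuclideanSpace.norm_eq, EuclideanSpace.norm_eq]
  refine Real.sqrt_le_sqrt (Finset.sum_le_sum fun i _ => ?_)
  have hq : 1 ≤ p / (p - 1) := by
    rw [le_div_iff₀ (by linarith)]
    linarith
  have key : ∀ a c : ℝ, 1 ≤ c → (a / c) * (a / c) ≤ a * a := fun a c hc => by
    rw [div_mul_div_comm]
    exact div_le_self (mul_self_nonneg a) (by nlinarith)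
  rw [Complex.sq_norm, Complex.sq_norm, Complex.normSq_apply, Complex.normSq_apply]
  exact add_le_add (key _ _ hp.le) (key _ _ hq)

/-- The differential of a power map in polar coordinates. -/
theorem powMapDeriv_polar (r : ℝ) {z : ℂ} (hz : z ≠ 0) (w : ℂ) :
    powMapDeriv r z w = ((‖z‖ ^ r : ℝ) : ℂ) * (z / ‖z‖) *
      (⟨(1 + r) * (conj (z / ‖z‖) * w).re, (conj (z / ‖z‖) * w).im⟩ : ℂ) := by
  have h := norm_pos_iff.2 hz
  have hc : (‖z‖ : ℂ) ≠ 0 := by exact_mod_cast h.ne'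
  have hzz : z * conj z = (‖z‖ : ℂ) ^ 2 := by
    rw [Complex.mul_conj, Complex.normSq_eq_norm_sq]
    push_cast
    rfl
  have hin : conj (z / ‖z‖) * w = ((‖z‖⁻¹ : ℝ) : ℂ) * (conj z * w) := by
    rw [map_div₀, Complex.conj_ofReal]
    push_cast
    field_simp
  have hre : inner ℝ z w = (conj z * w).re := by
    rw [Complex.inner, mul_comm]
  -- Adding the real number r⟨z, w⟩ to conj z * w touches only the real part, that is, the radial
  -- component, and multiplies it by 1 + r.
  have hsplit : (⟨(1 + r) * (conj (z / ‖z‖) * w).re, (conj (z / ‖z‖) * w).im⟩ : ℂ)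
      = ((‖z‖⁻¹ : ℝ) : ℂ) * (conj z * w + ((r * inner ℝ z w : ℝ) : ℂ)) := by
    rw [hin, hre, Complex.ext_iff]
    constructor
    · simp only [Complex.re_ofReal_mul, Complex.add_re, Complex.ofReal_re]
      ring
    · simp only [Complex.im_ofReal_mul, Complex.add_im, Complex.ofReal_im, add_zero]
  rw [hsplit, powMapDeriv, if_neg hz, Complex.real_smul, Complex.real_smul,
    show (‖z‖ ^ (r - 2) : ℝ) = ‖z‖ ^ r / ‖z‖ ^ 2 from by
      rw [Real.rpow_sub h, Real.rpow_two]]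
  push_cast
  field_simp
  linear_combination (-(((‖z‖ ^ r : ℝ) : ℂ) * w)) * hzz

/-- The pointwise identity behind the theorem: up to a unimodular factor and powers of `|z|`, the
two differentials are related by `𝒥_p`. -/
theorem exists_sesqForm_powMapDeriv_eq {p : ℝ} (hp : 1 < p) {z : ℂ} (hz : z ≠ 0)
    (ζ : EuclideanSpace ℂ (Fin n)) (M : Matrix (Fin n) (Fin n) ℂ) :
    ∃ ξ : EuclideanSpace ℂ (Fin n),
      ‖ξ‖ ^ 2 = ‖z‖ ^ (2 * ((p - 2) / p)) *
        ‖(WithLp.toLp 2 fun i => powMapDeriv ((2 - p) / p) z (ζ i) :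
          EuclideanSpace ℂ (Fin n))‖ ^ 2 ∧
      sesqForm M (WithLp.toLp 2 fun i => powMapDeriv ((2 - p) / p) z (ζ i))
        (WithLp.toLp 2 fun i => powMapDeriv ((p - 2) / p) z (ζ i))
        = p * sesqForm M ξ (Jmap p ξ) := by
  have h := norm_pos_iff.2 hz
  have hp0 : p ≠ 0 := by linarith
  have hp1 : p - 1 ≠ 0 := by linarith
  set θ : ℂ := z / ‖z‖ with hθ
  set τ : ℝ := (p - 2) / p with hτ
  have hθn : ‖θ‖ = 1 := by
    rw [hθ, norm_div, Complex.norm_real, norm_norm, div_self h.ne']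
  have hθθ : θ * conj θ = 1 := by
    rw [Complex.mul_conj, Complex.normSq_eq_norm_sq, hθn]
    simp
  have hτ' : (2 - p) / p = -τ := by rw [hτ]; ring
  have hpow : ((‖z‖ ^ (-τ) : ℝ) : ℂ) * ((‖z‖ ^ τ : ℝ) : ℂ) = 1 := by
    rw [← Complex.ofReal_mul, ← Real.rpow_add h]
    simp
  -- The factor i moves the radial part to the imaginary slot, where 𝒥_p divides by p'; then p/p' =
  -- p - 1 turns 1 - τ into 1 + τ and leaves the tangential part unchanged.
  let ξ : EuclideanSpace ℂ (Fin n) := WithLp.toLp 2 fun i =>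
    Complex.I * (⟨(1 - τ) * (conj θ * ζ i).re, (conj θ * ζ i).im⟩ : ℂ)
  have hJ : (p : ℂ) • Jmap p ξ = WithLp.toLp 2 fun i =>
      Complex.I * (⟨(1 + τ) * (conj θ * ζ i).re, (conj θ * ζ i).im⟩ : ℂ) := by
    ext i
    simp only [PiLp.smul_apply, Jmap, ξ, smul_eq_mul]
    rw [Complex.ext_iff]
    constructor
    · simp only [Complex.re_ofReal_mul, Complex.I_mul_re]
      field_simp
    · simp only [Complex.im_ofReal_mul, Complex.I_mul_im, hτ]
      field_simp
      ring
  have hu : (WithLp.toLp 2 fun i => powMapDeriv ((2 - p) / p) z (ζ i) :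
      EuclideanSpace ℂ (Fin n)) = (((‖z‖ ^ (-τ) : ℝ) : ℂ) * θ * -Complex.I) • ξ := by
    ext i
    simp only [PiLp.smul_apply, smul_eq_mul, ξ]
    rw [hτ', powMapDeriv_polar _ hz, ← hθ, ← sub_eq_add_neg]
    linear_combination ((((‖z‖ ^ (-τ) : ℝ) : ℂ) * θ *
      (⟨(1 - τ) * (conj θ * ζ i).re, (conj θ * ζ i).im⟩ : ℂ))) * Complex.I_mul_I
  have hw : (WithLp.toLp 2 fun i => powMapDeriv τ z (ζ i) :
      EuclideanSpace ℂ (Fin n)) = (((‖z‖ ^ τ : ℝ) : ℂ) * θ * -Complex.I * p) • Jmap p ξ := by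
    rw [mul_smul, hJ]
    ext i
    simp only [PiLp.smul_apply, smul_eq_mul]
    rw [powMapDeriv_polar _ hz, ← hθ]
    linear_combination ((((‖z‖ ^ τ : ℝ) : ℂ) * θ *
      (⟨(1 + τ) * (conj θ * ζ i).re, (conj θ * ζ i).im⟩ : ℂ))) * Complex.I_mul_I
  refine ⟨ξ, ?_, ?_⟩
  · rw [hu, norm_smul, norm_mul, norm_mul, hθn, Complex.norm_real,
      Real.norm_of_nonneg (by positivity), norm_neg, Complex.norm_I, mul_one, mul_one, mul_pow,
      ← mul_assoc, ← Real.rpow_natCast (‖z‖ ^ (-τ)), ← Real.rpow_mul h.le, ← Real.rpow_add h]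
    rw [show 2 * τ + -τ * ((2 : ℕ) : ℝ) = 0 by push_cast; ring, Real.rpow_zero, one_mul]
  · rw [hu, hw, sesqForm_smul_smul]
    simp only [map_mul, map_neg, Complex.conj_ofReal, Complex.conj_I]
    linear_combination (p * sesqForm M ξ (Jmap p ξ)) * (θ * conj θ * (-Complex.I * Complex.I)
      * hpow + (-Complex.I * Complex.I) * hθθ - Complex.I_mul_I)

/-- The pointwise bounds on the integrand, in terms of `u` with `z = |u|^{(p-2)/2} u`. -/
theorem sesqForm_powMapDeriv_bounds {p lam Lam : ℝ} (hp : 1 < p)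
    {M : Matrix (Fin n) (Fin n) ℂ}
    (hlower : ∀ ξ : EuclideanSpace ℂ (Fin n), lam * ‖ξ‖ ^ 2 ≤ (sesqForm M ξ (Jmap p ξ)).re)
    (hupper : ∀ ξ η : EuclideanSpace ℂ (Fin n), ‖sesqForm M ξ η‖ ≤ Lam * ‖ξ‖ * ‖η‖)
    (hLam : 0 ≤ Lam) (u : ℂ) (ζ : EuclideanSpace ℂ (Fin n))
    {U W : EuclideanSpace ℂ (Fin n)}
    (hU : U = WithLp.toLp 2 fun i => powMapDeriv ((2 - p) / p) (powMap ((p - 2) / 2) u) (ζ i))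
    (hW : W = WithLp.toLp 2 fun i => powMapDeriv ((p - 2) / p) (powMap ((p - 2) / 2) u) (ζ i)) :
    p * lam * (‖u‖ ^ (p - 2) * ‖U‖ ^ 2) ≤ (sesqForm M U W).re ∧
      ‖sesqForm M U W‖ ≤ p * Lam * (‖u‖ ^ (p - 2) * ‖U‖ ^ 2) := by
  have hp0 : 0 < p := by linarith
  -- At u = 0 the default value of `powMapDeriv` makes U vanish, so every term is 0 whatever value
  -- `‖u‖ ^ (p - 2)` takes there.
  rcases eq_or_ne u 0 with rfl | hu
  · have hU0 : U = 0 := by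
      rw [hU]
      ext i
      simp [powMapDeriv]
    subst hU0
    simp [sesqForm]
  have hn := norm_powMap ((p - 2) / 2) hu
  have hz : powMap ((p - 2) / 2) u ≠ 0 :=
    norm_pos_iff.1 (hn ▸ Real.rpow_pos_of_pos (norm_pos_iff.2 hu) _)
  obtain ⟨ξ, h1, h2⟩ := exists_sesqForm_powMapDeriv_eq hp hz ζ M
  rw [← hU, ← hW] at h2
  -- Here |z| = |u|^{p/2}, hence |z|^{2(p-2)/p} = |u|^{p-2}.
  rw [← hU, hn, ← Real.rpow_mul (norm_nonneg _),
    show ((p - 2) / 2 + 1) * (2 * ((p - 2) / p)) = p - 2 by field_simp; ring] at h1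
  rw [← h1, h2, Complex.re_ofReal_mul, norm_mul, Complex.norm_real, Real.norm_of_nonneg hp0.le,
    mul_assoc, mul_assoc]
  refine ⟨by gcongr; exact hlower ξ, ?_⟩
  gcongr
  calc ‖sesqForm M ξ (Jmap p ξ)‖ ≤ Lam * ‖ξ‖ * ‖Jmap p ξ‖ := hupper _ _
    _ ≤ Lam * ‖ξ‖ * ‖ξ‖ := by gcongr; exact norm_Jmap_le hp ξ
    _ = Lam * ‖ξ‖ ^ 2 := by ring

end Ellipticity

/-! ### Integration of the pointwise bounds. -/

theorem mainTheorem4 (p lam Lam : ℝ) (hp : 1 < p) (hlam : 0 < lam) (hLam : 0 < Lam) :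
    ∃ lam' : ℝ, 0 < lam' ∧
      ∀ (n : ℕ) (Ω : Set (EuclideanSpace ℝ (Fin n))), IsOpen Ω →
      ∀ A : EuclideanSpace ℝ (Fin n) → Matrix (Fin n) (Fin n) ℂ, IsPElliptic Ω A p lam Lam →
      ∀ χ : EuclideanSpace ℝ (Fin n) → ℝ, AEMeasurable χ (volume.restrict Ω) →
        (∃ M : ℝ, ∀ᵐ x ∂(volume.restrict Ω), 0 ≤ χ x ∧ χ x ≤ M) →
      ∀ u : EuclideanSpace ℝ (Fin n) → ℂ, MemW12Loc Ω (absPowMul ((p - 2) / 2) u) →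
        -- `∇u` and `∇(|u|^{p-2} u)` exist
        (∃ Gu, HasGradient Ω u Gu) ∧
        (∃ Gw, HasGradient Ω (absPowMul (p - 2) u) Gw) ∧
        ∀ Gu Gw : EuclideanSpace ℝ (Fin n) → EuclideanSpace ℂ (Fin n),
          HasGradient Ω u Gu → HasGradient Ω (absPowMul (p - 2) u) Gw →
          -- the inequality between integrals with values in `[0, ∞]`
          (∀ᵐ x ∂(volume.restrict Ω), 0 ≤ (sesqForm (A x) (Gu x) (Gw x)).re * χ x) ∧
          ENNReal.ofReal lam' *
              ∫⁻ x in Ω, ENNReal.ofReal (‖u x‖ ^ (p - 2) * ‖Gu x‖ ^ 2 * χ x)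
            ≤ ∫⁻ x in Ω, ENNReal.ofReal ((sesqForm (A x) (Gu x) (Gw x)).re * χ x) ∧
          -- if the right-hand side is finite, the left-hand side converges absolutely
          (IntegrableOn (fun x => ‖u x‖ ^ (p - 2) * ‖Gu x‖ ^ 2 * χ x) Ω volume →
            IntegrableOn (fun x => sesqForm (A x) (Gu x) (Gw x) * (χ x : ℂ)) Ω volume ∧
            lam' * ∫ x in Ω, ‖u x‖ ^ (p - 2) * ‖Gu x‖ ^ 2 * χ x
              ≤ (∫ x in Ω, sesqForm (A x) (Gu x) (Gw x) * (χ x : ℂ)).re) := by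
  -- The factor p is the one in ⟨A∇u, ∇w⟩ = p⟨Aξ, 𝒥_p ξ⟩; Λ serves only for absolute convergence.
  refine ⟨p * lam, by positivity, fun n Ω hΩ A hA χ hχm hχb u hu => ?_⟩
  have hp0 : p ≠ 0 := by linarith
  obtain ⟨Gv, hv, -⟩ := hu
  set v := absPowMul ((p - 2) / 2) u with hvdef
  have hvu : ∀ x, v x = powMap ((p - 2) / 2) (u x) := fun x => (Complex.real_smul).symm
  have hr1 : -1 < (2 - p) / p := by
    rw [lt_div_iff₀ (by linarith)]
    linarith
  have hr2 : -1 < (p - 2) / p := by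
    rw [lt_div_iff₀ (by linarith)]
    linarith
  have hu' : (fun x => powMap ((2 - p) / p) (v x)) = u := by
    funext x
    rw [hvu, powMap_powMap, show ((p - 2) / 2 + 1) * ((2 - p) / p) + (p - 2) / 2 = 0 by
      field_simp; ring]
    simp [powMap]
  have hw' : (fun x => powMap ((p - 2) / p) (v x)) = absPowMul (p - 2) u := by
    funext x
    rw [hvu, powMap_powMap, show ((p - 2) / 2 + 1) * ((p - 2) / p) + (p - 2) / 2 = p - 2 by
      field_simp; ring]
    exact Complex.real_smul
  have hGu := hv.hasGeneralizedGradient_powMap hΩ hr1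
  have hGw := hv.hasGeneralizedGradient_powMap hΩ hr2
  rw [hu'] at hGu
  rw [hw'] at hGw
  refine ⟨⟨_, .inr hGu⟩, ⟨_, .inr hGw⟩, fun Gu Gw hU hW => ?_⟩
  have hU' := hU.hasGeneralizedGradient hΩ
  have hW' := hW.hasGeneralizedGradient hΩ
  obtain ⟨B, hB⟩ := hχb
  -- Uniqueness replaces the given gradients a.e. by the explicit ones, to which the pointwise
  -- bounds apply.
  have hpt : ∀ᵐ x ∂(volume.restrict Ω),
      p * lam * (‖u x‖ ^ (p - 2) * ‖Gu x‖ ^ 2) ≤ (sesqForm (A x) (Gu x) (Gw x)).re ∧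
      ‖sesqForm (A x) (Gu x) (Gw x)‖ ≤ p * Lam * (‖u x‖ ^ (p - 2) * ‖Gu x‖ ^ 2) := by
    filter_upwards [hA.lower, hA.upper, hU'.ae_eq hGu hΩ, hW'.ae_eq hGw hΩ] with x h1 h2 h3 h4
    rw [hvu] at h3 h4
    exact sesqForm_powMapDeriv_bounds hp h1 h2 hLam.le (u x) (Gv x) h3 h4
  have hq : ∀ x, 0 ≤ ‖u x‖ ^ (p - 2) * ‖Gu x‖ ^ 2 := fun x => by positivity
  have hle : ∀ᵐ x ∂(volume.restrict Ω),
      p * lam * (‖u x‖ ^ (p - 2) * ‖Gu x‖ ^ 2 * χ x)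
        ≤ (sesqForm (A x) (Gu x) (Gw x)).re * χ x := by
    filter_upwards [hpt, hB] with x hx hχ
    rw [← mul_assoc]
    exact mul_le_mul_of_nonneg_right hx.1 hχ.1
  refine ⟨?_, ?_, fun hint => ?_⟩
  · filter_upwards [hle, hB] with x hx hχ
    have := mul_nonneg (hq x) hχ.1
    exact le_trans (by positivity) hx
  · rw [← lintegral_const_mul' _ _ ENNReal.ofReal_ne_top]
    refine lintegral_mono_ae ?_
    filter_upwards [hle] with x hx
    rw [← ENNReal.ofReal_mul (by positivity)]
    exact ENNReal.ofReal_le_ofReal hx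
  · have happ : ∀ {H : EuclideanSpace ℝ (Fin n) → EuclideanSpace ℂ (Fin n)} (i : Fin n),
        AEStronglyMeasurable H (volume.restrict Ω) →
        AEStronglyMeasurable (fun x => H x i) (volume.restrict Ω) := fun i hH =>
      (EuclideanSpace.proj i : EuclideanSpace ℂ (Fin n) →L[ℂ] ℂ).continuous
        |>.comp_aestronglyMeasurable hH
    have hSm : AEStronglyMeasurable (fun x => sesqForm (A x) (Gu x) (Gw x))
        (volume.restrict Ω) := by
      unfold sesqForm
      refine Finset.aestronglyMeasurable_fun_sum _ fun i _ =>
        Finset.aestronglyMeasurable_fun_sum _ fun j _ => ?_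
      exact ((hA.measurable i j).mul (happ j hU'.aestronglyMeasurable)).mul
        (Complex.continuous_conj.comp_aestronglyMeasurable (happ i hW'.aestronglyMeasurable))
    have hSi : IntegrableOn (fun x => sesqForm (A x) (Gu x) (Gw x) * (χ x : ℂ)) Ω volume := by
      refine (hint.const_mul (p * Lam)).mono'
        (hSm.mul (Complex.continuous_ofReal.comp_aestronglyMeasurable
          hχm.aestronglyMeasurable)) ?_
      filter_upwards [hpt, hB] with x hx hχ
      rw [norm_mul, Complex.norm_real, Real.norm_of_nonneg hχ.1, ← mul_assoc]
      exact mul_le_mul_of_nonneg_right hx.2 hχ.1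
    refine ⟨hSi, ?_⟩
    have hre : (∫ x in Ω, sesqForm (A x) (Gu x) (Gw x) * (χ x : ℂ)).re
        = ∫ x in Ω, (sesqForm (A x) (Gu x) (Gw x) * (χ x : ℂ)).re :=
      (integral_re hSi).symm
    rw [hre, ← integral_const_mul]
    refine integral_mono_ae (hint.const_mul _) hSi.re ?_
    filter_upwards [hle] with x hx
    simpa using hx
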